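/- Let $F$ be an arbitrary field and let $(S,n)$ be an $8$-dimensional quadratic space over $F$ whose polar form $b_n(x,y)=n(x+y)-n(x)-n(y)$ has radical $\{0\}$. A \emph{symmetric composition} on $(S,n)$ is an $F$-bilinear map $\star\colon S\times S\to S$ such that, for some $\lambda_\star\in F^\times$, $n(x\star y)=\lambda_\star n(x)n(y)$ and $b_n(x\star y,z)=b_n(x,y\star z)$ for all $x,y,z\in S$. Its opposite is $x\star^{\mathrm{op}}y=y\star x$. A similarity $f$ of $(S,n)$ with multiplier $\mu(f)$ induces the automorphism $C_0(f)$ of the even Clifford algebra $C_0(S,n)$ with $C_0(f)(xy)=\mu(f)^{-1}f(x)f(y)$ for $x,y\in S$; $f$ is \emph{proper} if $C_0(f)$ is the identity on the centre of $C_0(S,n)$. Let $\mathrm{GO}^+(n)$ be the group of proper similarities and $\mathrm{PGO}^+(n)=\mathrm{GO}^+(n)/F^\times$, with $[f]$ the class of $f$. Writing $\ell_x(y)=x\star y$ and $r_x(y)=y\star x$, let $\alpha_0^\star\colon C_0(S,n)\to\mathrm{End}_F S\times\mathrm{End}_F S$ be the algebra homomorphism with $\alpha_0^\star(xy)=(\lambda_\star^{-1}r_x\ell_y,\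 \lambda_\star^{-1}\ell_x r_y)$ for $x,y\in S$. The trialitarian automorphism $\rho_\star$ of $\mathrm{PGO}^+(n)$ maps $[f]$ to the unique $[g]$ such that $\alpha_0^\star\circ C_0(f)=(\mathrm{Int}(g)\times\mathrm{Int}(h))\circ\alpha_0^\star$ for some $h\in\mathrm{GO}^+(n)$. For maps $\sigma,\tau$ of $\mathrm{PGO}^+(n)$ to itself write $\sigma\equiv\tau$ if $\sigma=\mathrm{Int}(p)\circ\tau$ for some $p\in\mathrm{PGO}^+(n)$; here only the group $\mathrm{PGO}^+(n)$ of $F$-rational points is considered, so the congruence holds in particular whenever the corresponding automorphisms of algebraic groups over $F$ differ by the inner automorphism defined by an element of $\mathrm{PGO}^+(n)$. Let $\star$ and $\diamond$ be two symmetric compositions on $(S,n)$. (1) If $\rho_\star\equiv\rho_\diamond$, then there exist $f,g\in\mathrm{GO}^+(n)$ such that $x\diamond y=f(x)\star g(y)$ for all $x,y\in S$. (2) If $\rho_\star\equiv\rho_\diamond^{-1}$, then there exist $f,g\in\mathrm{GO}^+(n)$ such that $x\diamond y=g(y)\star f(x)$ for all $x,y\in S$. (3) In all cases, $\diamond$ is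 a twist of $\star$ or of $\star^{\mathrm{op}}$: there exist $f,g\in\mathrm{GO}^+(n)$ such that either $x\diamond y=f(x)\star g(y)$ for all $x,y\in S$, or $x\diamond y=f(x)\star^{\mathrm{op}}g(y)$ for all $x,y\in S$. -/

import Mathlib

universe u v

open CliffordAlgebra

noncomputable section

namespace Triality

section Similarities

variable {F : Type u} {S : Type v} [Field F] [AddCommGroup S] [Module F S]

/-- `f` is a similarity of the quadratic space `(S, n)` with multiplier `μ`. -/
def IsSimilarity (n : QuadraticForm F S) (f : S ≃ₗ[F] S) (μ : Fˣ) : Prop :=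
  ∀ x, n (f x) = (μ : F) * n x

theorem IsSimilarity.one (n : QuadraticForm F S) : IsSimilarity n 1 1 := by
  intro x; simp

theorem IsSimilarity.mul {n : QuadraticForm F S} {f g : S ≃ₗ[F] S} {μ ν : Fˣ}
    (hf : IsSimilarity n f μ) (hg : IsSimilarity n g ν) : IsSimilarity n (f * g) (μ * ν) := by
  intro x
  rw [LinearEquiv.mul_apply, hf, hg, Units.val_mul, mul_assoc]

theorem IsSimilarity.inv {n : QuadraticForm F S} {f : S ≃ₗ[F] S} {μ : Fˣ}
    (hf : IsSimilarity n f μ) : IsSimilarity n f⁻¹ μ⁻¹ := by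
  intro x
  have h := hf (f⁻¹ x)
  rw [← LinearEquiv.mul_apply, mul_inv_cancel] at h
  change n x = _ at h
  rw [h, ← mul_assoc, Units.inv_mul, one_mul]

/-- The automorphism `C₀(f)` of the even Clifford algebra induced by a similarity `f` with
multiplier `μ`: it maps `x * y` to `μ⁻¹ * f x * f y` for vectors `x`, `y`. -/
def evenCliffordMap (n : QuadraticForm F S) (f : S ≃ₗ[F] S) (μ : Fˣ) (hf : IsSimilarity n f μ) :
    CliffordAlgebra.even n →ₐ[F] CliffordAlgebra.even n :=
  CliffordAlgebra.even.lift n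
    { bilin := ((μ⁻¹ : Fˣ) : F) •
        (CliffordAlgebra.even.ι n).bilin.compl₁₂ (f : S →ₗ[F] S) (f : S →ₗ[F] S)
      contract := fun x => by
        simp only [LinearMap.smul_apply, LinearMap.compl₁₂_apply, LinearEquiv.coe_coe,
          EvenHom.contract, hf x]
        rw [Algebra.smul_def, ← map_mul, Units.inv_mul_cancel_left]
      contract_mid := fun x y z => by
        simp only [LinearMap.smul_apply, LinearMap.compl₁₂_apply, LinearEquiv.coe_coe,
          smul_mul_smul_comm, EvenHom.contract_mid, hf y, smul_smul]
        congr 1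
        rw [mul_assoc, Units.inv_mul_cancel_left, mul_comm] }

@[simp]
theorem evenCliffordMap_ι (n : QuadraticForm F S) (f : S ≃ₗ[F] S) (μ : Fˣ)
    (hf : IsSimilarity n f μ) (x y : S) :
    evenCliffordMap n f μ hf ((CliffordAlgebra.even.ι n).bilin x y) =
      ((μ⁻¹ : Fˣ) : F) • (CliffordAlgebra.even.ι n).bilin (f x) (f y) := by
  simp [evenCliffordMap]

theorem evenCliffordMap_one (n : QuadraticForm F S) (z : CliffordAlgebra.even n) :
    evenCliffordMap n 1 1 (IsSimilarity.one n) z = z := by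
  have h : evenCliffordMap n 1 1 (IsSimilarity.one n) = AlgHom.id F _ := by
    apply even.algHom_ext
    ext x y
    simp
  rw [h]; rfl

theorem evenCliffordMap_mul {n : QuadraticForm F S} {f g : S ≃ₗ[F] S} {μ ν : Fˣ}
    (hf : IsSimilarity n f μ) (hg : IsSimilarity n g ν) (z : CliffordAlgebra.even n) :
    evenCliffordMap n (f * g) (μ * ν) (hf.mul hg) z =
      evenCliffordMap n f μ hf (evenCliffordMap n g ν hg z) := by
  have h : evenCliffordMap n (f * g) (μ * ν) (hf.mul hg) =
      (evenCliffordMap n f μ hf).comp (evenCliffordMap n g ν hg) := by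
    apply even.algHom_ext
    ext x y
    simp [smul_smul, mul_comm]
  rw [h]; rfl

theorem evenCliffordMap_congr {n : QuadraticForm F S} {f g : S ≃ₗ[F] S} {μ ν : Fˣ}
    (hf : IsSimilarity n f μ) (hg : IsSimilarity n g ν) (hfg : f = g) (hμν : μ = ν) :
    evenCliffordMap n f μ hf = evenCliffordMap n g ν hg := by
  subst hfg hμν; rfl

/-- A similarity is proper if the induced automorphism of the even Clifford algebra is the
identity on the centre. -/
def IsProperSimilarity (n : QuadraticForm F S) (f : S ≃ₗ[F] S) : Prop :=
  ∃ (μ : Fˣ) (hf : IsSimilarity n f μ),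
    ∀ z ∈ Subalgebra.center F (CliffordAlgebra.even n), evenCliffordMap n f μ hf z = z

/-- The group `GO⁺(n)` of proper similarities. -/
def GOPlus (n : QuadraticForm F S) : Subgroup (S ≃ₗ[F] S) where
  carrier := {f | IsProperSimilarity n f}
  one_mem' := ⟨1, IsSimilarity.one n, fun z _ => evenCliffordMap_one n z⟩
  mul_mem' := by
    rintro f g ⟨μ, hf, hf'⟩ ⟨ν, hg, hg'⟩
    refine ⟨μ * ν, hf.mul hg, fun z hz => ?_⟩
    rw [evenCliffordMap_mul hf hg, hg' z hz, hf' z hz]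
  inv_mem' := by
    rintro f ⟨μ, hf, hf'⟩
    refine ⟨μ⁻¹, hf.inv, fun z hz => ?_⟩
    have h := evenCliffordMap_mul hf.inv hf z
    rw [hf' z hz] at h
    rw [← h, evenCliffordMap_congr (hf.inv.mul hf) (IsSimilarity.one n)
      (inv_mul_cancel f) (inv_mul_cancel μ), evenCliffordMap_one]

/-- The homotheties `x ↦ c • x` with `c ≠ 0`, as a subgroup of `GO⁺(n)`. -/
def homotheties (n : QuadraticForm F S) : Subgroup (GOPlus n) :=
  (DistribMulAction.toModuleAut F (S := Fˣ) S).range.subgroupOf (GOPlus n)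

theorem mem_homotheties {n : QuadraticForm F S} {f : GOPlus n} :
    f ∈ homotheties n ↔ ∃ c : Fˣ, ∀ x, f.1 x = (c : F) • x := by
  rw [homotheties, Subgroup.mem_subgroupOf, MonoidHom.mem_range]
  constructor
  · rintro ⟨c, hc⟩
    refine ⟨c, fun x => ?_⟩
    rw [← hc]; rfl
  · rintro ⟨c, hc⟩
    refine ⟨c, LinearEquiv.ext fun x => ?_⟩
    rw [hc]; rfl

instance homotheties_normal (n : QuadraticForm F S) : (homotheties n).Normal where
  conj_mem := by
    intro f hf g
    obtain ⟨c, hc⟩ := mem_homotheties.1 hf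
    refine mem_homotheties.2 ⟨c, fun x => ?_⟩
    change g.1 (f.1 (g.1⁻¹ x)) = _
    rw [hc, map_smul, ← LinearEquiv.mul_apply, mul_inv_cancel]
    rfl

/-- The group `PGO⁺(n) = GO⁺(n) / Fˣ`. -/
abbrev PGOPlus (n : QuadraticForm F S) : Type v := GOPlus n ⧸ homotheties n

/-- Two maps `σ, τ : PGO⁺(n) → PGO⁺(n)` are congruent modulo inner automorphisms:
`σ = Int(p) ∘ τ` for some `p` in `PGO⁺(n)`. -/
def CongrModInn (n : QuadraticForm F S) (σ τ : PGOPlus n → PGOPlus n) : Prop :=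
  ∃ p : PGOPlus n, ∀ φ, σ φ = p * τ φ * p⁻¹

end Similarities

section Compositions

variable {F : Type u} {S : Type v} [Field F] [AddCommGroup S] [Module F S]

/-- Symmetric compositions on `(S, n)`. -/
structure SymmetricComposition (n : QuadraticForm F S) where
  /-- the product `x ⋆ y` -/
  mul : S →ₗ[F] S →ₗ[F] S
  /-- the multiplier -/
  multiplier : Fˣ
  norm_mul : ∀ x y, n (mul x y) = (multiplier : F) * n x * n y
  polar_mul : ∀ x y z, QuadraticMap.polar n (mul x y) z = QuadraticMap.polar n x (mul y z)

namespace SymmetricComposition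

variable {n : QuadraticForm F S}

/-- The opposite composition `x ⋆ᵒᵖ y = y ⋆ x`. -/
def op (s : SymmetricComposition n) : SymmetricComposition n where
  mul := s.mul.flip
  multiplier := s.multiplier
  norm_mul := fun x y => by
    rw [LinearMap.flip_apply, s.norm_mul]; ring
  polar_mul := fun x y z => by
    rw [LinearMap.flip_apply, LinearMap.flip_apply, s.polar_mul, QuadraticMap.polar_comm,
      s.polar_mul]

theorem polar_mul_left (s : SymmetricComposition n) (x y z : S) :
    QuadraticMap.polar n (s.mul x y) (s.mul x z) =
      (s.multiplier : F) * n x * QuadraticMap.polar n y z := by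
  simp only [QuadraticMap.polar, ← map_add, s.norm_mul]; ring

/-- `(x ⋆ y) ⋆ x = λ n(x) y`. -/
theorem mul_mul_left (s : SymmetricComposition n) (hn : n.polarBilin.SeparatingLeft) (x y : S) :
    s.mul (s.mul x y) x = ((s.multiplier : F) * n x) • y := by
  rw [← sub_eq_zero]
  refine hn _ fun z => ?_
  rw [map_sub, LinearMap.sub_apply, map_smul, LinearMap.smul_apply, smul_eq_mul,
    QuadraticMap.polarBilin_apply_apply, QuadraticMap.polarBilin_apply_apply, s.polar_mul,
    s.polar_mul_left, sub_self]

/-- `x ⋆ (y ⋆ x) = λ n(x) y`. -/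
theorem mul_mul_right (s : SymmetricComposition n) (hn : n.polarBilin.SeparatingLeft) (x y : S) :
    s.mul x (s.mul y x) = ((s.multiplier : F) * n x) • y :=
  s.op.mul_mul_left hn x y

/-- Left multiplication `ℓ_x : y ↦ x ⋆ y`, linear in `x`. -/
def ell (s : SymmetricComposition n) : S →ₗ[F] Module.End F S := s.mul

/-- Right multiplication `r_x : y ↦ y ⋆ x`, linear in `x`. -/
def r (s : SymmetricComposition n) : S →ₗ[F] Module.End F S := s.mul.flip

theorem r_mul_ell (s : SymmetricComposition n) (hn : n.polarBilin.SeparatingLeft) (x : S) :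
    s.r x * s.ell x = ((s.multiplier : F) * n x) • (1 : Module.End F S) :=
  LinearMap.ext fun y => s.mul_mul_left hn x y

theorem ell_mul_r (s : SymmetricComposition n) (hn : n.polarBilin.SeparatingLeft) (x : S) :
    s.ell x * s.r x = ((s.multiplier : F) * n x) • (1 : Module.End F S) :=
  LinearMap.ext fun y => s.mul_mul_right hn x y

/-- The bilinear map `(x, y) ↦ λ⁻¹ a_x b_y` into `End S`. -/
def pairing (s : SymmetricComposition n) (a b : S →ₗ[F] Module.End F S) :
    S →ₗ[F] S →ₗ[F] Module.End F S :=
  ((s.multiplier⁻¹ : Fˣ) : F) • (LinearMap.mul F (Module.End F S)).compl₁₂ a b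

theorem pairing_apply (s : SymmetricComposition n) (a b : S →ₗ[F] Module.End F S) (x y : S) :
    s.pairing a b x y = ((s.multiplier⁻¹ : Fˣ) : F) • (a x * b y) := rfl

theorem pairing_self (s : SymmetricComposition n) {a b : S →ₗ[F] Module.End F S}
    (hab : ∀ x, a x * b x = ((s.multiplier : F) * n x) • (1 : Module.End F S)) (x : S) :
    s.pairing a b x x = algebraMap F _ (n x) := by
  rw [pairing_apply, hab, smul_smul, Units.inv_mul_cancel_left, Algebra.algebraMap_eq_smul_one]

theorem pairing_mul (s : SymmetricComposition n) {a b : S →ₗ[F] Module.End F S}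
    (hba : ∀ x, b x * a x = ((s.multiplier : F) * n x) • (1 : Module.End F S)) (x y z : S) :
    s.pairing a b x y * s.pairing a b y z = n y • s.pairing a b x z := by
  rw [pairing_apply, pairing_apply, pairing_apply, smul_mul_smul_comm, mul_assoc (a x),
    ← mul_assoc (b y), hba, smul_mul_assoc, one_mul, mul_smul_comm, smul_smul, smul_smul]
  congr 1
  rw [mul_assoc, Units.inv_mul_cancel_left, mul_comm]

/-- The `F`-algebra homomorphism `α₀ : C₀(S, n) → End S × End S` determined by
`α₀ (x * y) = (λ⁻¹ r_x ℓ_y, λ⁻¹ ℓ_x r_y)` for vectors `x`, `y`. -/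
def alpha (s : SymmetricComposition n) (hn : n.polarBilin.SeparatingLeft) :
    CliffordAlgebra.even n →ₐ[F] Module.End F S × Module.End F S :=
  AlgHom.prod
    (CliffordAlgebra.even.lift n
      { bilin := s.pairing s.r s.ell
        contract := s.pairing_self (s.r_mul_ell hn)
        contract_mid := s.pairing_mul (s.ell_mul_r hn) })
    (CliffordAlgebra.even.lift n
      { bilin := s.pairing s.ell s.r
        contract := s.pairing_self (s.ell_mul_r hn)
        contract_mid := s.pairing_mul (s.r_mul_ell hn) })

theorem alpha_ι (s : SymmetricComposition n) (hn : n.polarBilin.SeparatingLeft) (x y : S) :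
    s.alpha hn ((CliffordAlgebra.even.ι n).bilin x y) =
      (((s.multiplier⁻¹ : Fˣ) : F) • (s.r x * s.ell y),
        ((s.multiplier⁻¹ : Fˣ) : F) • (s.ell x * s.r y)) := by
  simp [alpha, pairing_apply]

/-- Commutativity of the square with top and bottom `α₀`, left side `C₀(f)` and right side
`Int(g) × Int(h)`. -/
def Diagram (s : SymmetricComposition n) (hn : n.polarBilin.SeparatingLeft)
    (f g h : S ≃ₗ[F] S) : Prop :=
  ∃ (μ : Fˣ) (hf : IsSimilarity n f μ), ∀ z : CliffordAlgebra.even n,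
    s.alpha hn (evenCliffordMap n f μ hf z) =
      (g.conj (s.alpha hn z).1, h.conj (s.alpha hn z).2)

open Classical in
/-- The trialitarian automorphism `ρ : PGO⁺(n) → PGO⁺(n)`: it maps `[f]` to the unique `[g]`
such that the diagram of `f`, `g`, `h` commutes for some proper similarity `h`. -/
def rho (s : SymmetricComposition n) (hn : n.polarBilin.SeparatingLeft) :
    PGOPlus n → PGOPlus n := fun φ =>
  Classical.epsilon fun ψ : PGOPlus n =>
    ∃ f g h : GOPlus n, (f : PGOPlus n) = φ ∧ (g : PGOPlus n) = ψ ∧ s.Diagram hn f.1 g.1 h.1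

/-- `d` is a twist of `s`: `x ⋄ y = f(x) ⋆ g(y)` for proper similarities `f` and `g`. -/
def IsTwist (d s : SymmetricComposition n) : Prop :=
  ∃ f ∈ GOPlus n, ∃ g ∈ GOPlus n, ∀ x y, d.mul x y = s.mul (f x) (g y)

end SymmetricComposition

end Compositions

end Triality

end

/-! The representation `α₀` is an isomorphism from `C₀(S, n)` onto `End S × End S`
(`alpha_bijective`). Comparing the `α₀` of two compositions therefore gives an automorphism of `End
S × End S`, which by Skolem–Noether is `Int(a) × Int(b)`, possibly after a switch of the factors;
replacing `⋆` by `⋆ᵒᵖ` absorbs the switch (`exists_alpha_eq`). Once the two `α₀` agree up to `Int(a)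
× Int(b)`, irreducibility of `S` under the operators `r_x ℓ_y` forces `x ⋄ a(z) = m b(x ⋆ z)` with
`m` a scalar. Norms show that `a` and `b` are similarities, and associativity of the polar form
gives `x ⋄ y = k a⁻¹(x) ⋆ b⁻¹(y)` (`exists_twist_of_alpha_eq`). Both maps belong to triality
triples, so they are proper. This is (3). For (1) and (2) the wrong alternative has to be excluded.
A triple with `f(y) ⋆ g(z) = ν h(y ⋆ z)` satisfies `ρ : [f] ↦ [g] ↦ [h] ↦ [f]`; passing to `⋆ᵒᵖ`
reverses the cycle, and a twist changes `ρ` only by an inner automorphism. The wrong alternative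
would thus make `[h]` conjugate to `[f]` in every triple, which an explicit product of two
reflections refutes over every field (`exists_trialityTriple_not_conj`). -/

noncomputable section

namespace Triality

/-! ### Dimension count for Clifford algebras, valid in every characteristic. -/

section WordSpan

variable {F S A : Type*} [Field F] [AddCommGroup S] [Module F S] [Ring A] [Algebra F A]

/-- The span of the products of the vectors `X (e i)`, `i < k`, taken in increasing order. -/
def wordSpan (X : S →ₗ[F] A) (e : ℕ → S) : ℕ → Submodule F A
  | 0 => 1
  | k + 1 => wordSpan X e k ⊔ (wordSpan X e k).map (LinearMap.mulRight F (X (e k)))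

theorem mem_wordSpan_succ {X : S →ₗ[F] A} {e : ℕ → S} {k : ℕ} {z : A} :
    z ∈ wordSpan X e (k + 1) ↔
      ∃ w ∈ wordSpan X e k, ∃ w' ∈ wordSpan X e k, z = w + w' * X (e k) := by
  simp only [wordSpan, Submodule.mem_sup, Submodule.mem_map, LinearMap.mulRight_apply]
  constructor
  · rintro ⟨w, hw, _, ⟨w', hw', rfl⟩, rfl⟩
    exact ⟨w, hw, w', hw', rfl⟩
  · rintro ⟨w, hw, w', hw', rfl⟩
    exact ⟨w, hw, _, ⟨w', hw', rfl⟩, rfl⟩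

theorem one_mem_wordSpan (X : S →ₗ[F] A) (e : ℕ → S) (k : ℕ) : 1 ∈ wordSpan X e k := by
  induction k with
  | zero => exact Submodule.one_le.mp le_rfl
  | succ k ih => exact Submodule.mem_sup_left ih

instance finite_wordSpan (X : S →ₗ[F] A) (e : ℕ → S) (k : ℕ) :
    Module.Finite F (wordSpan X e k) := by
  induction k with
  | zero => rw [wordSpan, Submodule.one_eq_span]; infer_instance
  | succ k ih => rw [wordSpan]; infer_instance

theorem finrank_wordSpan_le (X : S →ₗ[F] A) (e : ℕ → S) (k : ℕ) :
    Module.finrank F (wordSpan X e k) ≤ 2 ^ k := by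
  induction k with
  | zero =>
    rw [wordSpan, Submodule.one_eq_span, pow_zero]
    exact (finrank_span_le_card _).trans (by simp)
  | succ k ih =>
    have h₁ := Submodule.finrank_add_le_finrank_add_finrank (wordSpan X e k)
      ((wordSpan X e k).map (LinearMap.mulRight F (X (e k))))
    have h₂ := Submodule.finrank_map_le (LinearMap.mulRight F (X (e k))) (wordSpan X e k)
    rw [wordSpan, pow_succ]
    lia

section Clifford

variable {n : QuadraticForm F S} {X : S →ₗ[F] A} (hX : ∀ x, X x * X x = algebraMap F A (n x))
include hX

theorem mul_add_mul_swap_of_sq (x y : S) :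
    X x * X y + X y * X x = algebraMap F A (QuadraticMap.polar n x y) := by
  have h := hX (x + y)
  rw [map_add, add_mul, mul_add, mul_add, hX, hX] at h
  rw [QuadraticMap.polar, map_sub, map_sub, ← h]
  abel

/-- The Clifford relation moves `X (e i)` to the left past the last letter `X (e k)`, leaving a
scalar multiple of a shorter word. -/
theorem wordSpan_mul_mem (e : ℕ → S) {k i : ℕ} (hi : i < k) {z : A} (hz : z ∈ wordSpan X e k) :
    z * X (e i) ∈ wordSpan X e k := by
  induction k generalizing z with
  | zero => lia
  | succ k ih =>
    obtain ⟨w, hw, w', hw', rfl⟩ := mem_wordSpan_succ.1 hz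
    rcases Nat.lt_succ_iff_lt_or_eq.1 hi with hi | rfl
    · refine mem_wordSpan_succ.2 ⟨w * X (e i) + QuadraticMap.polar n (e k) (e i) • w',
        add_mem (ih hi hw) (Submodule.smul_mem _ _ hw'), -(w' * X (e i)), neg_mem (ih hi hw'), ?_⟩
      have h := mul_add_mul_swap_of_sq hX (e k) (e i)
      rw [Algebra.smul_def, Algebra.commutes, ← h]
      noncomm_ring
    · refine mem_wordSpan_succ.2 ⟨n (e i) • w', Submodule.smul_mem _ _ hw', w, hw, ?_⟩
      rw [Algebra.smul_def, Algebra.commutes, ← hX]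
      noncomm_ring

variable (θ : A →ₐ[F] A) (hθ : ∀ x, θ (X x) = -X x)
include hθ

theorem mul_wordSpan_of_polar_eq_zero (e : ℕ → S) {k : ℕ} {f : S}
    (hf : ∀ i < k, QuadraticMap.polar n f (e i) = 0) {z : A} (hz : z ∈ wordSpan X e k) :
    X f * z = θ z * X f := by
  induction k generalizing z with
  | zero =>
    obtain ⟨c, rfl⟩ := Submodule.mem_one.1 hz
    rw [AlgHom.commutes, Algebra.commutes]
  | succ k ih =>
    obtain ⟨w, hw, w', hw', rfl⟩ := mem_wordSpan_succ.1 hz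
    have ih' := fun {z} => ih (fun i hi => hf i (hi.trans (Nat.lt_succ_self k))) (z := z)
    have h := mul_add_mul_swap_of_sq hX f (e k)
    rw [hf k (Nat.lt_succ_self k), map_zero] at h
    rw [mul_add, ← mul_assoc, ih' hw, ih' hw', map_add, map_mul, hθ, add_mul, mul_assoc,
      eq_neg_of_add_eq_zero_left h]
    noncomm_ring

/-- Each new letter doubles the dimension. The dual vectors `f j` provide twisted commutators that
detect the coefficient of the new letter, so no orthogonal basis is needed. -/
theorem finrank_wordSpan [Nontrivial A] (hθi : Function.Injective θ) (e f : ℕ → S) {m : ℕ}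
    (hfe : ∀ j < m, ∀ i < m, QuadraticMap.polar n (f j) (e i) = if i = j then 1 else 0) {k : ℕ}
    (hk : k ≤ m) : Module.finrank F (wordSpan X e k) = 2 ^ k := by
  induction k with
  | zero => rw [wordSpan, Submodule.one_eq_span, pow_zero, finrank_span_singleton one_ne_zero]
  | succ k ih =>
    have key : ∀ w ∈ wordSpan X e k, ∀ w' ∈ wordSpan X e k, w + w' * X (e k) = 0 → w' = 0 := by
      intro w hw w' hw' h
      have h0 : ∀ i < k, QuadraticMap.polar n (f k) (e i) = 0 := fun i hi => by
        rw [hfe k (by lia) i (by lia), if_neg (by lia)]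
      have hp := mul_wordSpan_of_polar_eq_zero hX θ hθ e h0 hw
      have hp' := mul_wordSpan_of_polar_eq_zero hX θ hθ e h0 hw'
      have hq := mul_add_mul_swap_of_sq hX (f k) (e k)
      rw [hfe k (by lia) k (by lia), if_pos rfl, map_one] at hq
      -- The `θ`-twisted commutator with `X (f k)` vanishes on words in the earlier letters and
      -- takes `X (e k)` to `1`.
      have h₁ : X (f k) * (w + w' * X (e k)) - θ (w + w' * X (e k)) * X (f k) = θ w' := by
        rw [mul_add, ← mul_assoc, hp, hp', map_add, map_mul, hθ]
        calc _ = θ w' * (X (f k) * X (e k) + X (e k) * X (f k)) := by noncomm_ring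
          _ = _ := by rw [hq, mul_one]
      rw [h, map_zero, mul_zero, zero_mul, sub_zero] at h₁
      exact hθi (by rw [← h₁, map_zero])
    have h₂ : Module.finrank F ((wordSpan X e k).map (LinearMap.mulRight F (X (e k)))) = 2 ^ k := by
      rw [← ih (by lia), ← LinearMap.range_domRestrict]
      refine LinearMap.finrank_range_of_inj (LinearMap.ker_eq_bot.1 ?_)
      refine LinearMap.ker_eq_bot'.2 fun w hw => Subtype.ext ?_
      exact key 0 (zero_mem _) w w.2 (by rw [zero_add]; exact hw)
    have h₃ : wordSpan X e k ⊓ (wordSpan X e k).map (LinearMap.mulRight F (X (e k))) = ⊥ := by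
      rw [Submodule.eq_bot_iff]
      rintro _ ⟨hw, w', hw', rfl⟩
      rw [LinearMap.mulRight_apply] at hw ⊢
      rw [key _ (neg_mem hw) w' hw' (neg_add_cancel _), zero_mul]
    have h := Submodule.finrank_sup_add_finrank_inf_eq (wordSpan X e k)
      ((wordSpan X e k).map (LinearMap.mulRight F (X (e k))))
    rw [h₃, finrank_bot, h₂, ih (by lia)] at h
    rw [wordSpan, pow_succ]
    lia

end Clifford

theorem wordSpan_eq_top {n : QuadraticForm F S} {m : ℕ} (b : Module.Basis (Fin m) F S) (e : ℕ → S)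
    (he : ∀ i : Fin m, e i = b i) : wordSpan (CliffordAlgebra.ι n) e m = ⊤ := by
  rw [eq_top_iff]
  rintro z -
  induction z using CliffordAlgebra.right_induction with
  | algebraMap c =>
    rw [Algebra.algebraMap_eq_smul_one]
    exact Submodule.smul_mem _ _ (one_mem_wordSpan _ _ _)
  | add x y hx hy => exact add_mem hx hy
  | mul_ι x z hz =>
    rw [← b.sum_repr x, map_sum, Finset.mul_sum]
    refine sum_mem fun i _ => ?_
    rw [map_smul, mul_smul_comm, ← he]
    exact Submodule.smul_mem _ _ (wordSpan_mul_mem (CliffordAlgebra.ι_sq_scalar n) e i.2 hz)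

/-- An algebra map from the Clifford algebra of a nonsingular form of dimension `m` to an algebra of
dimension `2 ^ m` is bijective as soon as its restriction to vectors is compatible with a grading. -/
theorem bijective_of_finrank_eq {n : QuadraticForm F S} (hn : n.polarBilin.SeparatingLeft) {m : ℕ}
    [Module.Finite F S] [Nontrivial A]
    (hm : Module.finrank F S = m) [Module.Finite F A] (hA : Module.finrank F A = 2 ^ m)
    (Φ : CliffordAlgebra n →ₐ[F] A) (θ : A →ₐ[F] A)
    (hθ : ∀ x, θ (Φ (CliffordAlgebra.ι n x)) = -Φ (CliffordAlgebra.ι n x))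
    (hθi : Function.Injective θ) : Function.Bijective Φ := by
  let b : Module.Basis (Fin m) F S := Module.finBasisOfFinrankEq F S hm
  have hB : LinearMap.BilinForm.Nondegenerate n.polarBilin :=
    (LinearMap.IsRefl.nondegenerate_iff_separatingLeft
      (LinearMap.IsSymm.isRefl ⟨fun x y => QuadraticMap.polar_comm n x y⟩)).2 hn
  let e : ℕ → S := fun i => if h : i < m then b ⟨i, h⟩ else 0
  let f : ℕ → S := fun i => if h : i < m then
    LinearMap.BilinForm.dualBasis n.polarBilin hB b ⟨i, h⟩ else 0
  have he : ∀ i : Fin m, e i = b i := fun i => by simp [e]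
  have hfe : ∀ j < m, ∀ i < m, QuadraticMap.polar n (f j) (e i) = if i = j then 1 else 0 := by
    intro j hj i hi
    simp only [e, f, hi, hj, dif_pos]
    have h := LinearMap.BilinForm.apply_dualBasis_left (hB := hB) (b := b) ⟨j, hj⟩ ⟨i, hi⟩
    simpa using h
  let X : S →ₗ[F] A := Φ.toLinearMap ∘ₗ CliffordAlgebra.ι n
  have hX : ∀ x, X x * X x = algebraMap F A (n x) := fun x => by
    rw [← Φ.commutes, ← CliffordAlgebra.ι_sq_scalar, map_mul]; rfl
  have hW := finrank_wordSpan hX θ hθ hθi e f hfe le_rfl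
  -- The words fill `A`, which gives surjectivity; since the Clifford algebra is spanned by at most
  -- `2 ^ m` words, injectivity follows.
  have htop : wordSpan X e m = ⊤ :=
    Submodule.eq_top_of_finrank_eq (hW.trans hA.symm)
  have hle : ∀ k, wordSpan X e k ≤ (wordSpan (CliffordAlgebra.ι n) e k).map Φ.toLinearMap := by
    intro k z hz
    induction k generalizing z with
    | zero =>
      obtain ⟨c, rfl⟩ := Submodule.mem_one.1 hz
      exact ⟨algebraMap F _ c, Submodule.mem_one.2 ⟨c, rfl⟩, Φ.commutes c⟩
    | succ k ih =>
      obtain ⟨w, hw, w', hw', rfl⟩ := mem_wordSpan_succ.1 hz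
      obtain ⟨y, hy, rfl⟩ := ih hw
      obtain ⟨y', hy', rfl⟩ := ih hw'
      exact ⟨y + y' * CliffordAlgebra.ι n (e k), mem_wordSpan_succ.2 ⟨y, hy, y', hy', rfl⟩, by
        simp [X]⟩
  have hsurj : Function.Surjective Φ := fun z => by
    obtain ⟨y, -, hy⟩ := hle m (htop ▸ Submodule.mem_top : z ∈ _)
    exact ⟨y, hy⟩
  have htopC := wordSpan_eq_top (n := n) b e he
  have : Module.Finite F (CliffordAlgebra n) := by
    have h := finite_wordSpan (CliffordAlgebra.ι n) e m
    rw [htopC] at h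
    exact Module.Finite.of_surjective (⊤ : Submodule F (CliffordAlgebra n)).subtype
      (fun x => ⟨⟨x, trivial⟩, rfl⟩)
  have hC : Module.finrank F (CliffordAlgebra n) ≤ 2 ^ m := by
    rw [← finrank_top F (CliffordAlgebra n), ← htopC]
    exact finrank_wordSpan_le _ _ _
  have hC' : Module.finrank F A ≤ Module.finrank F (CliffordAlgebra n) :=
    LinearMap.finrank_le_finrank_of_surjective (f := Φ.toLinearMap) hsurj
  exact ⟨(LinearMap.injective_iff_surjective_of_finrank_eq_finrank (f := Φ.toLinearMap)
    (by lia)).2 hsurj, hsurj⟩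

end WordSpan

/-! ### The isomorphism `α₀`. -/

namespace SymmetricComposition

variable {F : Type*} {S : Type*} [Field F] [AddCommGroup S] [Module F S] {n : QuadraticForm F S}

@[simp]
theorem ell_apply (s : SymmetricComposition n) (x y : S) : s.ell x y = s.mul x y := rfl

@[simp]
theorem r_apply (s : SymmetricComposition n) (x y : S) : s.r x y = s.mul y x := rfl

/-- The Clifford map `x ↦ ((u, v) ↦ (λ⁻¹ r_x v, ℓ_x u))`. -/
def cliffordVector (s : SymmetricComposition n) : S →ₗ[F] Module.End F (S × S) where
  toFun x := LinearMap.prod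
    ((((s.multiplier⁻¹ : Fˣ) : F) • s.r x) ∘ₗ LinearMap.snd F S S) (s.ell x ∘ₗ LinearMap.fst F S S)
  map_add' x y := by ext <;> simp
  map_smul' c x := by ext <;> simp [smul_comm c]

theorem cliffordVector_apply (s : SymmetricComposition n) (x : S) (p : S × S) :
    s.cliffordVector x p = (((s.multiplier⁻¹ : Fˣ) : F) • s.mul p.2 x, s.mul x p.1) := rfl

theorem cliffordVector_mul_self (s : SymmetricComposition n) (hn : n.polarBilin.SeparatingLeft)
    (x : S) : s.cliffordVector x * s.cliffordVector x = algebraMap F _ (n x) := by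
  refine LinearMap.ext fun p => ?_
  rw [Module.End.mul_apply, cliffordVector_apply, cliffordVector_apply, map_smul,
    s.mul_mul_left hn, s.mul_mul_right hn, smul_smul, smul_smul, Units.inv_mul_cancel_left]
  rfl

/-- The representation of the Clifford algebra on `S × S` which extends `α₀`. -/
def cliffordRep (s : SymmetricComposition n) (hn : n.polarBilin.SeparatingLeft) :
    CliffordAlgebra n →ₐ[F] Module.End F (S × S) :=
  CliffordAlgebra.lift n ⟨s.cliffordVector, s.cliffordVector_mul_self hn⟩

@[simp]
theorem cliffordRep_ι (s : SymmetricComposition n) (hn : n.polarBilin.SeparatingLeft) (x : S) :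
    s.cliffordRep hn (CliffordAlgebra.ι n x) = s.cliffordVector x := by
  simp [cliffordRep]

theorem cliffordRep_bijective (s : SymmetricComposition n) (hdim : Module.finrank F S = 8)
    (hn : n.polarBilin.SeparatingLeft) : Function.Bijective (s.cliffordRep hn) := by
  have : Module.Finite F S := Module.finite_of_finrank_pos (by lia)
  have : Nontrivial S := Module.nontrivial_of_finrank_pos (R := F) (by lia)
  -- Vectors act by off-diagonal blocks, so conjugation by `(1, -1)` negates them.
  let t : (S × S) ≃ₗ[F] S × S := (LinearEquiv.refl F S).prodCongr (LinearEquiv.neg F)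
  refine bijective_of_finrank_eq hn hdim ?_ _ (t.conjAlgEquiv F : _ →ₐ[F] _) (fun x => ?_)
    (t.conjAlgEquiv F).injective
  · refine (Module.finrank_linearMap F F (S × S) (S × S)).trans ?_
    rw [Module.finrank_prod, hdim]; norm_num
  · refine LinearMap.ext fun p => ?_
    have h : t.symm p = (p.1, -p.2) := by
      rw [LinearEquiv.symm_apply_eq]; simp [t]
    rw [cliffordRep_ι]
    change t (s.cliffordVector x (t.symm p)) = -(s.cliffordVector x p)
    rw [h]
    simp [t, cliffordVector_apply]

theorem cliffordRep_even (s : SymmetricComposition n) (hn : n.polarBilin.SeparatingLeft)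
    (z : CliffordAlgebra.even n) :
    s.cliffordRep hn z = LinearMap.prodMap (s.alpha hn z).1 (s.alpha hn z).2 := by
  have h : (s.cliffordRep hn).comp (CliffordAlgebra.even n).val =
      (LinearMap.prodMapAlgHom F S S).comp (s.alpha hn) := by
    apply even.algHom_ext
    ext x y : 3
    change s.cliffordRep hn (CliffordAlgebra.ι n x * CliffordAlgebra.ι n y) =
      LinearMap.prodMap (s.alpha hn ((even.ι n).bilin x y)).1 (s.alpha hn ((even.ι n).bilin x y)).2
    rw [alpha_ι, map_mul, cliffordRep_ι, cliffordRep_ι]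
    refine LinearMap.ext fun p => ?_
    simp [cliffordVector_apply]
  exact DFunLike.congr_fun h z

theorem cliffordRep_odd (s : SymmetricComposition n) (hn : n.polarBilin.SeparatingLeft)
    {z : CliffordAlgebra n} (hz : z ∈ evenOdd n 1) (u v : S) :
    (s.cliffordRep hn z (u, 0)).1 = 0 ∧ (s.cliffordRep hn z (0, v)).2 = 0 := by
  induction z, hz using CliffordAlgebra.odd_induction with
  | ι x => simp [cliffordVector_apply]
  | add x y hx hy ihx ihy => simp [ihx, ihy]
  | ι_mul_ι_mul x y z hz ih => simp [cliffordVector_apply, ih]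

theorem alpha_bijective (s : SymmetricComposition n) (hdim : Module.finrank F S = 8)
    (hn : n.polarBilin.SeparatingLeft) : Function.Bijective (s.alpha hn) := by
  obtain ⟨hi, hs⟩ := s.cliffordRep_bijective hdim hn
  constructor
  · intro z z' h
    refine Subtype.ext (hi ?_)
    rw [cliffordRep_even, cliffordRep_even, h]
  · rintro ⟨p, q⟩
    obtain ⟨z, hz⟩ := hs (LinearMap.prodMap p q)
    -- The odd part of a preimage contributes nothing to the diagonal blocks, so its even part is
    -- already a preimage under `α₀`.
    obtain ⟨z₀, h₀, z₁, h₁, rfl⟩ := Submodule.mem_sup.1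
      ((evenOdd_isCompl n).sup_eq_top ▸ Submodule.mem_top : z ∈ _)
    refine ⟨⟨z₀, h₀⟩, Prod.ext (LinearMap.ext fun u => ?_) (LinearMap.ext fun v => ?_)⟩
    · have h := congr_arg Prod.fst (LinearMap.congr_fun hz (u, 0))
      rw [map_add, LinearMap.add_apply, Prod.fst_add, (s.cliffordRep_odd hn h₁ u 0).1,
        s.cliffordRep_even hn ⟨z₀, h₀⟩, add_zero] at h
      exact h
    · have h := congr_arg Prod.snd (LinearMap.congr_fun hz (0, v))
      rw [map_add, LinearMap.add_apply, Prod.snd_add, (s.cliffordRep_odd hn h₁ 0 v).2,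
        s.cliffordRep_even hn ⟨z₀, h₀⟩, add_zero] at h
      exact h

theorem alpha_op (s : SymmetricComposition n) (hn : n.polarBilin.SeparatingLeft)
    (z : CliffordAlgebra.even n) : s.op.alpha hn z = (s.alpha hn z).swap := by
  have h : s.op.alpha hn = (AlgHom.prod (AlgHom.snd F _ _) (AlgHom.fst F _ _)).comp
      (s.alpha hn) := by
    apply even.algHom_ext
    ext x y : 3
    simp only [EvenHom.compr₂, LinearMap.compr₂_apply, AlgHom.toLinearMap_apply, AlgHom.comp_apply,
      alpha_ι]
    rfl
  rw [h]; rfl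

end SymmetricComposition

/-! ### Automorphisms of `End S × End S`. -/

section Endomorphisms

variable {F : Type*} {S : Type*} [Field F] [AddCommGroup S] [Module F S]

theorem exists_eq_conj_of_injective [Module.Finite F S] (f : Module.End F S →ₐ[F] Module.End F S)
    (hf : Function.Injective f) : ∃ a : S ≃ₗ[F] S, ∀ p, f p = a.conj p := by
  obtain ⟨a, ha⟩ := (AlgEquiv.ofBijective f ⟨hf,
    (LinearMap.injective_iff_surjective (f := f.toLinearMap)).1 hf⟩).eq_linearEquivConjAlgEquiv
  exact ⟨a, fun p => DFunLike.congr_fun ha p⟩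

theorem exists_conj_of_algEquiv_prod_of_map_fst [Module.Finite F S]
    (φ : (Module.End F S × Module.End F S) ≃ₐ[F] (Module.End F S × Module.End F S))
    (hφ : φ (1, 0) = (1, 0)) :
    ∃ a b : S ≃ₗ[F] S, ∀ p, φ p = (a.conj p.1, b.conj p.2) := by
  have hφ' : φ (0, 1) = (0, 1) := by
    have h : φ (0, 1) = φ 1 - φ (1, 0) := by rw [← map_sub]; simp [Prod.one_eq_mk]
    rw [h, hφ, map_one]; simp [Prod.one_eq_mk]
  have h₁ : ∀ p, (φ (p, 0)).2 = 0 := fun p => by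
    have h : φ (p, 0) = φ (p, 0) * φ (1, 0) := by rw [← map_mul]; simp
    rw [h, hφ]; simp
  have h₂ : ∀ p, (φ (0, p)).1 = 0 := fun p => by
    have h : φ (0, p) = φ (0, p) * φ (0, 1) := by rw [← map_mul]; simp
    rw [h, hφ']; simp
  let f : Module.End F S →ₐ[F] Module.End F S := AlgHom.ofLinearMap
    (LinearMap.fst F _ _ ∘ₗ φ.toLinearMap ∘ₗ LinearMap.inl F _ _) (by simp [hφ])
    (fun p q => by simp [← Prod.fst_mul, ← map_mul])
  let g : Module.End F S →ₐ[F] Module.End F S := AlgHom.ofLinearMap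
    (LinearMap.snd F _ _ ∘ₗ φ.toLinearMap ∘ₗ LinearMap.inr F _ _) (by simp [hφ'])
    (fun p q => by simp [← Prod.snd_mul, ← map_mul])
  obtain ⟨a, ha⟩ := exists_eq_conj_of_injective f fun p q h => by
    have h' : φ (p, 0) = φ (q, 0) := Prod.ext h (by rw [h₁, h₁])
    simpa using h'
  obtain ⟨b, hb⟩ := exists_eq_conj_of_injective g fun p q h => by
    have h' : φ (0, p) = φ (0, q) := Prod.ext (by rw [h₂, h₂]) h
    simpa using h'
  refine ⟨a, b, fun p => ?_⟩
  have h : φ p = φ (p.1, 0) + φ (0, p.2) := by rw [← map_add]; simp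
  rw [h, ← ha, ← hb]
  refine Prod.ext ?_ ?_
  · rw [Prod.fst_add, h₂, add_zero]; rfl
  · rw [Prod.snd_add, h₁, zero_add]; rfl

/-- An automorphism of `End S × End S` is a product of inner automorphisms, up to a switch of the
factors. -/
theorem exists_conj_of_algEquiv_prod [Module.Finite F S]
    (φ : (Module.End F S × Module.End F S) ≃ₐ[F] (Module.End F S × Module.End F S)) :
    ∃ a b : S ≃ₗ[F] S, (∀ p, φ p = (a.conj p.1, b.conj p.2)) ∨
      (∀ p, φ p = (a.conj p.2, b.conj p.1)) := by
  -- The image of `(1, 0)` is a central idempotent, hence has components `0` or `1`; injectivity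
  -- leaves only `(1, 0)` and `(0, 1)`.
  obtain ⟨⟨E₁, E₂⟩, hE⟩ : ∃ E, φ (1, 0) = E := ⟨_, rfl⟩
  have hid : (E₁ * E₁, E₂ * E₂) = (E₁, E₂) := by
    have h : φ (1, 0) * φ (1, 0) = φ (1, 0) := by rw [← map_mul]; simp
    rwa [hE] at h
  have hcomm : ∀ q, (E₁, E₂) * q = q * (E₁, E₂) := fun q => by
    obtain ⟨p, rfl⟩ := φ.surjective q
    rw [← hE, ← map_mul, ← map_mul]; simp [Prod.mul_def]
  have hc : ∀ E : Module.End F S, (∀ q, E * q = q * E) → E * E = E → E = 0 ∨ E = 1 := by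
    intro E hE
    obtain ⟨c, -, rfl⟩ := Module.End.mem_center_iff.1
      (Semigroup.mem_center_iff.2 fun q => (hE q).symm)
    refine fun hEE => or_iff_not_imp_left.2 fun h => ?_
    have hc0 : c ≠ 0 := fun h0 => h (LinearMap.ext fun x => by simp [h0])
    refine LinearMap.ext fun x => smul_right_injective S hc0 ?_
    exact LinearMap.congr_fun hEE x
  have h₁ := hc E₁ (fun q => congr_arg Prod.fst (hcomm (q, 0))) (congr_arg Prod.fst hid)
  have h₂ := hc E₂ (fun q => congr_arg Prod.snd (hcomm (0, q))) (congr_arg Prod.snd hid)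
  rcases subsingleton_or_nontrivial S with hS | hS
  · exact ⟨1, 1, Or.inl fun p => Subsingleton.elim _ _⟩
  rcases h₁ with rfl | rfl <;> rcases h₂ with rfl | rfl
  · have h := φ.injective (hE.trans (map_zero φ).symm)
    simp at h
  · let swap : (Module.End F S × Module.End F S) ≃ₐ[F] (Module.End F S × Module.End F S) :=
      { RingEquiv.prodComm with commutes' := fun _ => rfl }
    obtain ⟨a, b, h⟩ := exists_conj_of_algEquiv_prod_of_map_fst (φ.trans swap) (by simp [hE, swap])
    exact ⟨b, a, Or.inr fun p => by
      rw [← Prod.swap_inj]; exact h p⟩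
  · obtain ⟨a, b, h⟩ := exists_conj_of_algEquiv_prod_of_map_fst φ hE
    exact ⟨a, b, Or.inl h⟩
  · have h := φ.injective (hE.trans (map_one φ).symm)
    simp [Prod.one_eq_mk] at h

end Endomorphisms

/-! ### Similarities and triality triples. -/

section Similarity

variable {F : Type*} {S : Type*} [Field F] [AddCommGroup S] [Module F S] {n : QuadraticForm F S}

theorem eq_of_polar_eq (hn : n.polarBilin.SeparatingLeft) {x y : S}
    (h : ∀ z, QuadraticMap.polar n x z = QuadraticMap.polar n y z) : x = y := by
  rw [← sub_eq_zero]
  refine hn _ fun z => ?_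
  rw [map_sub, LinearMap.sub_apply, QuadraticMap.polarBilin_apply_apply,
    QuadraticMap.polarBilin_apply_apply, h, sub_self]

theorem exists_ne_zero_of_separatingLeft [Nontrivial S] (hn : n.polarBilin.SeparatingLeft) :
    ∃ x, n x ≠ 0 := by
  by_contra! h
  obtain ⟨x, hx⟩ := exists_ne (0 : S)
  exact hx (hn x fun y => by simp [QuadraticMap.polar, h])

theorem IsSimilarity.polar {f : S ≃ₗ[F] S} {μ : Fˣ} (hf : IsSimilarity n f μ) (x y : S) :
    QuadraticMap.polar n (f x) (f y) = (μ : F) * QuadraticMap.polar n x y := by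
  simp only [QuadraticMap.polar, ← map_add, hf _]; ring

theorem exists_isSimilarity {f : S ≃ₗ[F] S} {c : F} (hex : ∃ x, n x ≠ 0)
    (h : ∀ x, n (f x) = c * n x) : ∃ μ, IsSimilarity n f μ := by
  obtain ⟨x, hx⟩ := hex
  have hc : c ≠ 0 := by
    rintro rfl
    have h' := h (f.symm x)
    rw [LinearEquiv.apply_symm_apply, zero_mul] at h'
    exact hx h'
  exact ⟨Units.mk0 c hc, h⟩

end Similarity

namespace SymmetricComposition

variable {F : Type*} {S : Type*} [Field F] [AddCommGroup S] [Module F S] {n : QuadraticForm F S}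

/-- The similarities `f`, `g`, `h` satisfy `f(y) ⋆ g(z) = ν h(y ⋆ z)` for some scalar `ν ≠ 0`. -/
structure TrialityTriple (s : SymmetricComposition n) (f g h : S ≃ₗ[F] S) : Prop where
  left : ∃ μ, IsSimilarity n f μ
  right : ∃ μ, IsSimilarity n g μ
  out : ∃ μ, IsSimilarity n h μ
  rel : ∃ ν : Fˣ, ∀ y z, s.mul (f y) (g z) = (ν : F) • h (s.mul y z)

namespace TrialityTriple

variable {s : SymmetricComposition n} {f g h f' g' h' : S ≃ₗ[F] S}

/-- The trilinear form `b(x ⋆ y, z)` is invariant under cyclic permutation. -/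
theorem rotate (t : s.TrialityTriple f g h) (hn : n.polarBilin.SeparatingLeft) :
    s.TrialityTriple h f g := by
  obtain ⟨⟨μf, hf⟩, ⟨μg, hg⟩, ⟨μh, hh⟩, ν, hν⟩ := t
  refine ⟨⟨μh, hh⟩, ⟨μf, hf⟩, ⟨μg, hg⟩, ν * μh * μg⁻¹, fun w y => eq_of_polar_eq hn fun z => ?_⟩
  obtain ⟨z, rfl⟩ := g.surjective z
  rw [s.polar_mul, hν, QuadraticMap.polar_smul_right, hh.polar, QuadraticMap.polar_smul_left,
    hg.polar, s.polar_mul, Units.val_mul, Units.val_mul, smul_eq_mul, smul_eq_mul]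
  rw [mul_assoc _ (↑μg⁻¹ : F), Units.inv_mul_cancel_left, mul_assoc]

theorem mul (t : s.TrialityTriple f g h) (t' : s.TrialityTriple f' g' h') :
    s.TrialityTriple (f * f') (g * g') (h * h') := by
  obtain ⟨⟨μf, hf⟩, ⟨μg, hg⟩, ⟨μh, hh⟩, ν, hν⟩ := t
  obtain ⟨⟨μf', hf'⟩, ⟨μg', hg'⟩, ⟨μh', hh'⟩, ν', hν'⟩ := t'
  refine ⟨⟨_, hf.mul hf'⟩, ⟨_, hg.mul hg'⟩, ⟨_, hh.mul hh'⟩, ν * ν', fun y z => ?_⟩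
  simp only [LinearEquiv.mul_apply, hν, hν', map_smul, smul_smul, Units.val_mul]

theorem inv (t : s.TrialityTriple f g h) : s.TrialityTriple f⁻¹ g⁻¹ h⁻¹ := by
  obtain ⟨⟨μf, hf⟩, ⟨μg, hg⟩, ⟨μh, hh⟩, ν, hν⟩ := t
  refine ⟨⟨_, hf.inv⟩, ⟨_, hg.inv⟩, ⟨_, hh.inv⟩, ν⁻¹, fun y z => h.injective ?_⟩
  obtain ⟨y, rfl⟩ := f.surjective y
  obtain ⟨z, rfl⟩ := g.surjective z
  simp only [← LinearEquiv.mul_apply, inv_mul_cancel]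
  rw [hν, map_smul, ← LinearEquiv.mul_apply, mul_inv_cancel, LinearEquiv.coe_one]
  simp only [id, smul_smul, Units.inv_mul, one_smul]

/-- The relation for `(f, g, h)` and the one for the rotated triple `(h, f, g)` together transport
`r_x ℓ_y` and `ℓ_x r_y`. -/
theorem diagram [Nontrivial S] (t : s.TrialityTriple f g h) (hn : n.polarBilin.SeparatingLeft) :
    s.Diagram hn f g h := by
  obtain ⟨ν', hν'⟩ := (t.rotate hn).rel
  obtain ⟨⟨μ, hf⟩, -, -, ν, hν⟩ := t
  refine ⟨μ, hf, ?_⟩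
  -- Evaluate `(f(y) ⋆ g(y)) ⋆ f(y)` in two ways at a vector with `n y ≠ 0`.
  have hμ : (μ : F) = ν * ν' := by
    obtain ⟨y, hy⟩ := exists_ne_zero_of_separatingLeft hn
    have hy0 : y ≠ 0 := by rintro rfl; simp at hy
    have h₁ := s.mul_mul_left hn (f y) (g y)
    rw [hν, map_smul, LinearMap.smul_apply, hν', smul_smul, s.mul_mul_left hn, map_smul, smul_smul,
      hf] at h₁
    have h₂ := smul_left_injective F (g.map_ne_zero_iff.2 hy0) h₁
    have h₃ : (s.multiplier : F) * n y ≠ 0 := mul_ne_zero s.multiplier.ne_zero hy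
    refine mul_right_cancel₀ h₃ ?_
    linear_combination -h₂
  have key : (s.alpha hn).comp (evenCliffordMap n f μ hf) =
      (AlgHom.prod ((g.conjAlgEquiv F : _ →ₐ[F] _).comp (AlgHom.fst F _ _))
        ((h.conjAlgEquiv F : _ →ₐ[F] _).comp (AlgHom.snd F _ _))).comp (s.alpha hn) := by
    apply even.algHom_ext
    ext x y : 3
    simp only [EvenHom.compr₂, LinearMap.compr₂_apply, AlgHom.toLinearMap_apply, AlgHom.comp_apply,
      evenCliffordMap_ι, map_smul, alpha_ι]
    refine Prod.ext (LinearMap.ext fun w => ?_) (LinearMap.ext fun w => ?_)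
    · obtain ⟨z, rfl⟩ := g.surjective w
      change ((μ⁻¹ : Fˣ) : F) • ((s.multiplier⁻¹ : Fˣ) : F) • s.mul (s.mul (f y) (g z)) (f x) =
        g (((s.multiplier⁻¹ : Fˣ) : F) • s.mul (s.mul y (g.symm (g z))) x)
      rw [LinearEquiv.symm_apply_apply, hν, map_smul, LinearMap.smul_apply, hν', map_smul,
        smul_comm, smul_smul (ν : F), ← hμ, smul_smul ((μ⁻¹ : Fˣ) : F), Units.inv_mul, one_smul]
    · obtain ⟨z, rfl⟩ := h.surjective w
      change ((μ⁻¹ : Fˣ) : F) • ((s.multiplier⁻¹ : Fˣ) : F) • s.mul (f x) (s.mul (h z) (f y)) =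
        h (((s.multiplier⁻¹ : Fˣ) : F) • s.mul x (s.mul (h.symm (h z)) y))
      rw [LinearEquiv.symm_apply_apply, hν', map_smul, hν, map_smul,
        smul_comm, smul_smul (ν' : F), mul_comm (ν' : F), ← hμ, smul_smul ((μ⁻¹ : Fˣ) : F),
        Units.inv_mul, one_smul]
  exact fun z => DFunLike.congr_fun key z

end TrialityTriple

variable {s d : SymmetricComposition n}

theorem conj_eq_self_of_mem_center {p : Module.End F S}
    (hp : ∀ q : Module.End F S, p * q = q * p) (g : S ≃ₗ[F] S) : g.conj p = p := by
  refine LinearMap.ext fun x => ?_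
  rw [LinearEquiv.conj_apply_apply]
  have h := LinearMap.congr_fun (hp (g : S →ₗ[F] S)) (g.symm x)
  simpa using h.symm

/-- Under the isomorphism `α₀` the centre of `C₀(S, n)` becomes the centre of `End S × End S`, which
inner automorphisms fix pointwise. -/
theorem Diagram.mem_GOPlus {f g h : S ≃ₗ[F] S} {hn : n.polarBilin.SeparatingLeft}
    (hd : s.Diagram hn f g h) (hdim : Module.finrank F S = 8) : f ∈ GOPlus n := by
  obtain ⟨μ, hf, H⟩ := hd
  obtain ⟨hi, hs⟩ := s.alpha_bijective hdim hn
  refine ⟨μ, hf, fun z hz => hi ?_⟩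
  have hc : ∀ p, s.alpha hn z * p = p * s.alpha hn z := fun p => by
    obtain ⟨y, rfl⟩ := hs p
    rw [← map_mul, ← map_mul, Subalgebra.mem_center_iff.1 hz]
  rw [H, conj_eq_self_of_mem_center fun q => congr_arg Prod.fst (hc (q, 0)),
    conj_eq_self_of_mem_center fun q => congr_arg Prod.snd (hc (0, q))]

theorem TrialityTriple.mem_GOPlus {f g h : S ≃ₗ[F] S} (t : s.TrialityTriple f g h)
    (hdim : Module.finrank F S = 8) (hn : n.polarBilin.SeparatingLeft) :
    f ∈ GOPlus n ∧ g ∈ GOPlus n ∧ h ∈ GOPlus n := by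
  have : Nontrivial S := Module.nontrivial_of_finrank_pos (R := F) (by lia)
  exact ⟨(t.diagram hn).mem_GOPlus hdim, ((t.rotate hn).rotate hn |>.diagram hn).mem_GOPlus hdim,
    ((t.rotate hn).diagram hn).mem_GOPlus hdim⟩

theorem exists_eq_smul_of_forall_commute {M : Module.End F S} (hM : ∀ p, p * M = M * p) :
    ∃ m : F, ∀ x, M x = m • x := by
  obtain ⟨m, -, rfl⟩ := Module.End.mem_center_iff.1 (Semigroup.mem_center_iff.2 hM)
  exact ⟨m, fun x => rfl⟩

/-- A form of Schur's lemma: the hypothesis says that `M` commutes with all `r_x ℓ_y`, and these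
generate `End S` because `α₀` is surjective. -/
theorem exists_eq_smul_of_map_mul_mul (s : SymmetricComposition n)
    (hdim : Module.finrank F S = 8) (hn : n.polarBilin.SeparatingLeft) {M : Module.End F S}
    (hM : ∀ x y z, M (s.mul (s.mul y z) x) = s.mul (s.mul y (M z)) x) :
    ∃ m : F, ∀ x, M x = m • x := by
  have h : ∀ (z : CliffordAlgebra n) (hz : z ∈ evenOdd n 0),
      (s.alpha hn ⟨z, hz⟩).1 * M = M * (s.alpha hn ⟨z, hz⟩).1 := by
    intro z hz
    induction z, hz using CliffordAlgebra.even_induction with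
    | algebraMap c =>
      have h : (s.alpha hn (algebraMap F (CliffordAlgebra.even n) c)).1 =
        algebraMap F (Module.End F S) c := by rw [AlgHom.commutes]; rfl
      change (s.alpha hn (algebraMap F (CliffordAlgebra.even n) c)).1 * M =
        M * (s.alpha hn (algebraMap F (CliffordAlgebra.even n) c)).1
      rw [h, Algebra.commutes]
    | add x y hx hy ihx ihy =>
      have h : s.alpha hn ⟨x + y, add_mem hx hy⟩ = s.alpha hn ⟨x, hx⟩ + s.alpha hn ⟨y, hy⟩ :=
        map_add (s.alpha hn) ⟨x, hx⟩ ⟨y, hy⟩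
      rw [h, Prod.fst_add, add_mul, mul_add, ihx, ihy]
    | ι_mul_ι_mul x y z hz ih =>
      change (s.alpha hn ((even.ι n).bilin x y * ⟨z, hz⟩)).1 * M =
        M * (s.alpha hn ((even.ι n).bilin x y * ⟨z, hz⟩)).1
      rw [map_mul, Prod.fst_mul, mul_assoc, ih, ← mul_assoc, ← mul_assoc, alpha_ι]
      congr 1
      refine LinearMap.ext fun w => ?_
      simp [hM]
  refine exists_eq_smul_of_forall_commute fun p => ?_
  obtain ⟨⟨z, hz⟩, hp⟩ := (s.alpha_bijective hdim hn).2 (p, 0)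
  have h' := h z hz
  rwa [hp] at h'

/-! ### From conjugate representations to twists. -/

/-- If `α₀` of `d` is obtained from `α₀` of `s` by inner automorphisms, then `d` and `s` are
related through the corresponding linear maps. -/
theorem exists_mul_eq_of_alpha_eq (hdim : Module.finrank F S = 8)
    (hn : n.polarBilin.SeparatingLeft) {a b : S ≃ₗ[F] S}
    (H : ∀ z, d.alpha hn z = (a.conj (s.alpha hn z).1, b.conj (s.alpha hn z).2)) :
    ∃ m m' : F, m ≠ 0 ∧ m' ≠ 0 ∧ (∀ x z, d.mul x (a z) = m • b (s.mul x z)) ∧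
      ∀ w y, d.mul (b w) y = m' • a (s.mul w y) := by
  have : Nontrivial S := Module.nontrivial_of_finrank_pos (R := F) (by lia)
  obtain ⟨e, he⟩ := exists_ne_zero_of_separatingLeft hn
  have hs : (s.multiplier : F) * n e ≠ 0 := mul_ne_zero s.multiplier.ne_zero he
  have hd : (d.multiplier : F) * n e ≠ 0 := mul_ne_zero d.multiplier.ne_zero he
  have he0 : e ≠ 0 := by rintro rfl; simp at he
  set c : F := (d.multiplier : F) * ((s.multiplier⁻¹ : Fˣ) : F) with hc
  have hc0 : c ≠ 0 := mul_ne_zero d.multiplier.ne_zero (Units.ne_zero _)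
  have hR : ∀ x y w, d.mul (d.mul y (a w)) x = c • a (s.mul (s.mul y w) x) := fun x y w => by
    have h := LinearMap.congr_fun (congr_arg Prod.fst (H ((even.ι n).bilin x y))) (a w)
    rw [alpha_ι, alpha_ι, LinearEquiv.conj_apply_apply, LinearEquiv.symm_apply_apply] at h
    simp only [LinearMap.smul_apply, Module.End.mul_apply, ell_apply, r_apply, map_smul] at h
    rw [hc, mul_smul, ← h, smul_smul, Units.mul_inv, one_smul]
  have hL : ∀ x y w, d.mul x (d.mul (b w) y) = c • b (s.mul x (s.mul w y)) := fun x y w => by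
    have h := LinearMap.congr_fun (congr_arg Prod.snd (H ((even.ι n).bilin x y))) (b w)
    rw [alpha_ι, alpha_ι, LinearEquiv.conj_apply_apply, LinearEquiv.symm_apply_apply] at h
    simp only [LinearMap.smul_apply, Module.End.mul_apply, ell_apply, r_apply, map_smul] at h
    rw [hc, mul_smul, ← h, smul_smul, Units.mul_inv, one_smul]
  have hinj : ∀ x y, s.mul e x = s.mul e y → x = y := fun x y h => by
    have h' := congr_arg (fun z => s.mul z e) h
    simp only [s.mul_mul_left hn] at h'
    exact smul_right_injective S hs h'
  -- `M` is the solution of `e ⋄ a(z) = b(e ⋆ M(z))`; by `hL` the same `M` works with every `x` in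
  -- place of `e`.
  let M : Module.End F S := (c * ((d.multiplier : F) * n e)⁻¹) •
    (s.r e ∘ₗ (b.symm : S →ₗ[F] S) ∘ₗ d.ell e ∘ₗ (a : S →ₗ[F] S))
  have hM : ∀ x z, d.mul x (a z) = b (s.mul x (M z)) := fun x z => by
    have h := hL x e (b.symm (d.mul e (a z)))
    rw [LinearEquiv.apply_symm_apply, d.mul_mul_left hn, map_smul] at h
    simp only [M, LinearMap.smul_apply, LinearMap.comp_apply, LinearEquiv.coe_coe, map_smul,
      ell_apply, r_apply]
    rw [mul_comm, mul_smul, ← h, smul_smul, inv_mul_cancel₀ hd, one_smul]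
  have hM' : ∀ w y, M (a.symm (d.mul (b w) y)) = c • s.mul w y := fun w y => by
    refine hinj _ _ (b.injective ?_)
    rw [← hM, LinearEquiv.apply_symm_apply, hL, map_smul, map_smul]
  obtain ⟨m, hm⟩ := s.exists_eq_smul_of_map_mul_mul hdim hn (M := M) fun x y z => by
    have h := hM' (s.mul y (M z)) x
    rw [← hM, hR, map_smul, map_smul, LinearEquiv.symm_apply_apply] at h
    exact smul_right_injective S hc0 h
  have hm0 : m ≠ 0 := by
    rintro rfl
    have h := d.mul_mul_right hn e e
    rw [← a.apply_symm_apply (d.mul e e), hM, hm, zero_smul, map_zero, map_zero] at h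
    exact smul_ne_zero hd he0 h.symm
  refine ⟨m, m⁻¹ * c, hm0, mul_ne_zero (inv_ne_zero hm0) hc0, fun x z => ?_, fun w y => ?_⟩
  · rw [hM, hm, map_smul, map_smul]
  · have h := hM' w y
    rw [hm] at h
    rw [mul_smul, ← map_smul a, ← h, map_smul, LinearEquiv.apply_symm_apply, smul_smul,
      inv_mul_cancel₀ hm0, one_smul]

/-- The triality triple is what later shows that `a` and `b` are proper and that they relate the two
trialitarian automorphisms. -/
theorem exists_twist_of_alpha_eq (hdim : Module.finrank F S = 8)
    (hn : n.polarBilin.SeparatingLeft) {a b : S ≃ₗ[F] S}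
    (H : ∀ z, d.alpha hn z = (a.conj (s.alpha hn z).1, b.conj (s.alpha hn z).2)) :
    s.TrialityTriple a⁻¹ (b⁻¹ * a) b ∧
      ∃ k : Fˣ, ∀ x y, d.mul x y = (k : F) • s.mul (a⁻¹ x) (b⁻¹ y) := by
  have : Nontrivial S := Module.nontrivial_of_finrank_pos (R := F) (by lia)
  obtain ⟨m, m', hm, hm', h₁, h₂⟩ := exists_mul_eq_of_alpha_eq hdim hn H
  have hex := exists_ne_zero_of_separatingLeft hn
  obtain ⟨e, he⟩ := hex
  have hs : (s.multiplier : F) * n e ≠ 0 := mul_ne_zero s.multiplier.ne_zero he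
  obtain ⟨μa, ha⟩ : ∃ μ, IsSimilarity n a μ := by
    -- Since `e ⋆ (v ⋆ e) = λ n(e) v`, the vector `a(v)` is a multiple of `b(e) ⋄ (v ⋆ e)`, whose
    -- norm is a constant times `n v`.
    refine exists_isSimilarity ⟨e, he⟩
      (c := d.multiplier * n (b e) * (m' ^ 2 * ((s.multiplier : F) * n e))⁻¹) fun v => ?_
    have h := congr_arg n (h₂ e (s.mul v e))
    rw [d.norm_mul, s.norm_mul, s.mul_mul_right hn, map_smul a, QuadraticMap.map_smul,
      QuadraticMap.map_smul, smul_eq_mul, smul_eq_mul] at h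
    field_simp at h ⊢
    linear_combination -h
  obtain ⟨μb, hb⟩ : ∃ μ, IsSimilarity n b μ := by
    refine exists_isSimilarity ⟨e, he⟩
      (c := d.multiplier * n (a e) * (m ^ 2 * ((s.multiplier : F) * n e))⁻¹) fun v => ?_
    have h := congr_arg n (h₁ (s.mul e v) e)
    rw [d.norm_mul, s.norm_mul, s.mul_mul_left hn, map_smul b, QuadraticMap.map_smul,
      QuadraticMap.map_smul, smul_eq_mul, smul_eq_mul] at h
    field_simp at h ⊢
    linear_combination -h
  -- Pair with `x` and shift the product by associativity of the polar form, so that `h₁` applies to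
  -- `x ⋄ y`.
  have hk : ∀ x y, d.mul x y = (m * μb) • s.mul (a⁻¹ x) (b⁻¹ y) := fun y z => by
    refine eq_of_polar_eq hn fun x => ?_
    rw [QuadraticMap.polar_comm, ← d.polar_mul, QuadraticMap.polar_smul_left,
      QuadraticMap.polar_comm n _ x, ← s.polar_mul, smul_eq_mul, mul_assoc, ← hb.polar]
    obtain ⟨y, rfl⟩ := a.surjective y
    obtain ⟨z, rfl⟩ := b.surjective z
    rw [h₁, QuadraticMap.polar_smul_left, smul_eq_mul]
    simp only [← LinearEquiv.mul_apply, inv_mul_cancel]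
    rfl
  let k : Fˣ := Units.mk0 m hm * μb
  refine ⟨⟨⟨_, ha.inv⟩, ⟨_, hb.inv.mul ha⟩, ⟨_, hb⟩, Units.mk0 m hm * k⁻¹, fun y z => ?_⟩,
    k, hk⟩
  have h := hk y (a z)
  rw [h₁] at h
  rw [Units.val_mul, Units.val_mk0, mul_comm, mul_smul, h, smul_smul]
  change _ = (((k⁻¹ : Fˣ) : F) * (k : F)) • _
  rw [Units.inv_mul, one_smul]
  rfl

theorem exists_alpha_eq (s d : SymmetricComposition n) (hdim : Module.finrank F S = 8)
    (hn : n.polarBilin.SeparatingLeft) : ∃ a b : S ≃ₗ[F] S,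
      (∀ z, d.alpha hn z = (a.conj (s.alpha hn z).1, b.conj (s.alpha hn z).2)) ∨
      (∀ z, d.alpha hn z = (a.conj (s.op.alpha hn z).1, b.conj (s.op.alpha hn z).2)) := by
  have : Module.Finite F S := Module.finite_of_finrank_pos (by lia)
  let αs := AlgEquiv.ofBijective _ (s.alpha_bijective hdim hn)
  let αd := AlgEquiv.ofBijective _ (d.alpha_bijective hdim hn)
  have h : ∀ z, d.alpha hn z = αs.symm.trans αd (s.alpha hn z) := fun z => by
    change αd z = αd (αs.symm (αs z))
    rw [AlgEquiv.symm_apply_apply]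
  obtain ⟨a, b, H | H⟩ := exists_conj_of_algEquiv_prod (αs.symm.trans αd)
  · exact ⟨a, b, Or.inl fun z => by rw [h, H]⟩
  · exact ⟨a, b, Or.inr fun z => by rw [h, H, alpha_op]; rfl⟩

end SymmetricComposition

/-! ### Projective similarities, sandwich maps and the values of `ρ`. -/

section Projective

variable {F : Type*} {S : Type*} [Field F] [AddCommGroup S] [Module F S] {n : QuadraticForm F S}

theorem exists_linearEquiv_of_map_eq [Module.Finite F S] (hn : n.polarBilin.SeparatingLeft)
    (p : Module.End F S) (c : Fˣ) (h : ∀ x, n (p x) = c * n x) :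
    ∃ f : S ≃ₗ[F] S, (∀ x, f x = p x) ∧ IsSimilarity n f c := by
  have hp : Function.Injective p := by
    rw [← LinearMap.ker_eq_bot, LinearMap.ker_eq_bot']
    intro x hx
    refine hn x fun y => ?_
    have hxy : QuadraticMap.polar n (p x) (p y) = c * QuadraticMap.polar n x y := by
      simp only [QuadraticMap.polar, ← map_add, h]; ring
    rw [hx, QuadraticMap.polar_zero_left] at hxy
    exact (mul_eq_zero_iff_left c.ne_zero).1 hxy.symm
  exact ⟨LinearEquiv.ofBijective p ⟨hp, LinearMap.injective_iff_surjective.1 hp⟩,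
    fun _ => rfl, h⟩

theorem mk_eq_mk_iff {f g : GOPlus n} :
    (f : PGOPlus n) = g ↔ ∃ c : Fˣ, ∀ x, g.1 x = (c : F) • f.1 x := by
  rw [QuotientGroup.eq, mem_homotheties]
  refine exists_congr fun c => forall_congr' fun x => ?_
  change f.1⁻¹ (g.1 x) = _ ↔ _
  rw [← map_smul]
  exact LinearEquiv.symm_apply_eq f.1

theorem evenCliffordMap_eq_of_smul {f g : S ≃ₗ[F] S} {μ ν : Fˣ} (hex : ∃ x, n x ≠ 0)
    (hf : IsSimilarity n f μ) (hg : IsSimilarity n g ν) {c : Fˣ}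
    (h : ∀ x, g x = (c : F) • f x) : evenCliffordMap n g ν hg = evenCliffordMap n f μ hf := by
  obtain ⟨e, he⟩ := hex
  have hν : (ν : F) = c * c * μ := by
    have h' := hg e
    rw [h, QuadraticMap.map_smul, hf, smul_eq_mul] at h'
    refine mul_right_cancel₀ he ?_
    rw [← h']; ring
  have hν' : ν = c * c * μ := Units.ext hν
  subst hν'
  apply even.algHom_ext
  ext x y : 3
  simp only [EvenHom.compr₂, LinearMap.compr₂_apply, AlgHom.toLinearMap_apply, evenCliffordMap_ι,
    h, map_smul, LinearMap.smul_apply, smul_smul]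
  congr 1
  simp only [mul_inv_rev, Units.val_mul]
  rw [mul_assoc, mul_assoc, Units.inv_mul_cancel_left, Units.inv_mul, mul_one]

/-- The map `y ↦ b(v, y) v - n(v) y`, that is `y ↦ v y v` in the Clifford algebra. -/
def sandwich (n : QuadraticForm F S) (v : S) : Module.End F S :=
  (n.polarBilin v).smulRight v - n v • 1

theorem sandwich_apply (v y : S) :
    sandwich n v y = QuadraticMap.polar n v y • v - n v • y := by
  simp [sandwich]

theorem map_sandwich (v y : S) : n (sandwich n v y) = n v * n v * n y := by
  have h := QuadraticMap.map_add n (QuadraticMap.polar n v y • v) (-(n v • y))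
  rw [← sub_eq_add_neg, ← sandwich_apply, QuadraticMap.map_neg, QuadraticMap.map_smul,
    QuadraticMap.map_smul, QuadraticMap.polar_neg_right, QuadraticMap.polar_smul_left,
    QuadraticMap.polar_smul_right] at h
  simp only [smul_eq_mul] at h
  linear_combination h

/-- Two linear forms on a nonsingular quadratic space of dimension `8` have a common zero which is
not singular. -/
theorem exists_ne_zero_of_linear_forms (hdim : Module.finrank F S = 8)
    (hn : n.polarBilin.SeparatingLeft) (φ ψ : S →ₗ[F] F) :
    ∃ x, φ x = 0 ∧ ψ x = 0 ∧ n x ≠ 0 := by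
  have : Module.Finite F S := Module.finite_of_finrank_pos (by lia)
  by_contra! h
  let K : Submodule F S := LinearMap.ker (φ.prod ψ)
  have hK : ∀ x ∈ K, n x = 0 := fun x hx => by
    have hx' : (φ x, ψ x) = 0 := hx
    exact h x (congr_arg Prod.fst hx') (congr_arg Prod.snd hx')
  have h₁ := (φ.prod ψ).finrank_range_add_finrank_ker
  have h₂ : Module.finrank F (LinearMap.range (φ.prod ψ)) ≤ 2 :=
    (Submodule.finrank_le _).trans (by simp)
  have hB : LinearMap.BilinForm.Nondegenerate n.polarBilin :=
    (LinearMap.IsRefl.nondegenerate_iff_separatingLeft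
      (LinearMap.IsSymm.isRefl ⟨fun x y => QuadraticMap.polar_comm n x y⟩)).2 hn
  have h₃ := LinearMap.BilinForm.finrank_orthogonal hB K
  -- A totally singular `K` has dimension at most `4`, whereas two linear forms leave dimension at
  -- least `6`.
  have h₄ : K ≤ LinearMap.BilinForm.orthogonal n.polarBilin K := fun x hx y hy => by
    change QuadraticMap.polar n y x = 0
    rw [QuadraticMap.polar, hK _ hx, hK _ hy, hK _ (add_mem hy hx)]; simp
  have h₅ := Submodule.finrank_mono h₄
  change _ + Module.finrank F K = _ at h₁
  lia

end Projective

namespace SymmetricComposition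

variable {F : Type*} {S : Type*} [Field F] [AddCommGroup S] [Module F S] {n : QuadraticForm F S}
  {s d : SymmetricComposition n}

/-- This makes the choice in `rho` harmless: `C₀(f)` depends only on `[f]`, and as `α₀` is onto it
determines `Int(g)`, hence `g` up to a scalar. -/
theorem rho_mk (hdim : Module.finrank F S = 8) {hn : n.polarBilin.SeparatingLeft}
    {f g h : GOPlus n} (D : s.Diagram hn f.1 g.1 h.1) :
    s.rho hn (f : PGOPlus n) = g := by
  have : Nontrivial S := Module.nontrivial_of_finrank_pos (R := F) (by lia)
  have hex : ∃ ψ : PGOPlus n, ∃ f' g' h' : GOPlus n, (f' : PGOPlus n) = f ∧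
    (g' : PGOPlus n) = ψ ∧ s.Diagram hn f'.1 g'.1 h'.1 := ⟨g, f, g, h, rfl, rfl, D⟩
  obtain ⟨f', g', h', hf, hg, D'⟩ := Classical.epsilon_spec hex
  change Classical.epsilon _ = _
  rw [← hg]
  obtain ⟨c, hc⟩ := mk_eq_mk_iff.1 hf.symm
  obtain ⟨μ, hμ, H⟩ := D
  obtain ⟨μ', hμ', H'⟩ := D'
  rw [evenCliffordMap_eq_of_smul (exists_ne_zero_of_separatingLeft hn) hμ hμ' hc] at H'
  have hconj : ∀ p, g.1.conj p = g'.1.conj p := fun p => by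
    obtain ⟨z, hz⟩ := (s.alpha_bijective hdim hn).2 (p, 0)
    have h₁ := congr_arg Prod.fst ((H z).symm.trans (H' z))
    rwa [hz] at h₁
  obtain ⟨m, hm⟩ := exists_eq_smul_of_forall_commute
    (M := (g.1.symm : S →ₗ[F] S) ∘ₗ (g'.1 : S →ₗ[F] S)) fun p => by
    refine LinearMap.ext fun x => g.1.injective ?_
    have h₁ := LinearMap.congr_fun (hconj p) (g'.1 x)
    rw [LinearEquiv.conj_apply_apply, LinearEquiv.conj_apply_apply,
      LinearEquiv.symm_apply_apply] at h₁
    simpa using h₁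
  have hm' : ∀ x, g'.1 x = m • g.1 x := fun x => by
    rw [← map_smul, ← hm]; simp
  have hm0 : m ≠ 0 := by
    rintro rfl
    obtain ⟨x, hx⟩ := exists_ne (0 : S)
    have h₁ := hm' x
    rw [zero_smul] at h₁
    exact hx ((LinearEquiv.map_eq_zero_iff _).1 h₁)
  exact (mk_eq_mk_iff.2 ⟨Units.mk0 m hm0, hm'⟩).symm

theorem Diagram.op {f g h : S ≃ₗ[F] S} {hn : n.polarBilin.SeparatingLeft}
    (D : s.Diagram hn f g h) : s.op.Diagram hn f h g := by
  obtain ⟨μ, hf, H⟩ := D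
  exact ⟨μ, hf, fun z => by rw [alpha_op, H, alpha_op]; rfl⟩

theorem Diagram.conj {f g h a b : S ≃ₗ[F] S} {hn : n.polarBilin.SeparatingLeft}
    (D : s.Diagram hn f g h)
    (H : ∀ z, d.alpha hn z = (a.conj (s.alpha hn z).1, b.conj (s.alpha hn z).2)) :
    d.Diagram hn f (a * g * a⁻¹) (b * h * b⁻¹) := by
  obtain ⟨μ, hf, hD⟩ := D
  refine ⟨μ, hf, fun z => ?_⟩
  have hconj : ∀ (a g : S ≃ₗ[F] S) (p : Module.End F S),
      (a * g * a⁻¹).conj (a.conj p) = a.conj (g.conj p) := fun a g p => by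
    refine LinearMap.ext fun x => ?_
    change a (g (a.symm (a (p (a.symm (a (g.symm (a.symm x)))))))) = a (g (p (g.symm (a.symm x))))
    rw [LinearEquiv.symm_apply_apply, LinearEquiv.symm_apply_apply]
  rw [H, hD, H, hconj, hconj]

/-! ### An explicit triple separating `ρ` from its inverse. -/

theorem mul_mul_add_mul_mul (s : SymmetricComposition n) (hn : n.polarBilin.SeparatingLeft)
    (x y w : S) : s.mul x (s.mul w y) + s.mul y (s.mul w x) =
      ((s.multiplier : F) * QuadraticMap.polar n x y) • w := by
  have h := s.mul_mul_right hn (x + y) w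
  simp only [map_add, LinearMap.add_apply, s.mul_mul_right hn] at h
  rw [QuadraticMap.polar, mul_sub, mul_sub, sub_smul, sub_smul, ← h]
  abel

theorem sandwich_mul (s : SymmetricComposition n) (hn : n.polarBilin.SeparatingLeft) (v y z : S) :
    (s.multiplier : F) • s.mul (sandwich n v y) z = s.mul v (s.mul (s.mul v z) y) := by
  rw [eq_sub_of_add_eq (s.mul_mul_add_mul_mul hn v y (s.mul v z)), s.mul_mul_left hn,
    sandwich_apply, map_sub, LinearMap.sub_apply, map_smul, map_smul, map_smul,
    LinearMap.smul_apply, LinearMap.smul_apply, smul_sub, smul_smul, smul_smul]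

theorem mul_sandwich (s : SymmetricComposition n) (hn : n.polarBilin.SeparatingLeft) (v y z : S) :
    (s.multiplier : F) • s.mul z (sandwich n v y) = s.mul (s.mul y (s.mul z v)) v :=
  s.op.sandwich_mul hn v y z

/-- The triality triple attached to a product of two reflections. -/
theorem exists_trialityTriple_of_ne_zero [Module.Finite F S] (s : SymmetricComposition n)
    (hn : n.polarBilin.SeparatingLeft) {u v : S} (hu : n u ≠ 0) (hv : n v ≠ 0) :
    ∃ f g h : S ≃ₗ[F] S, s.TrialityTriple f g h ∧ (∀ x, f x = sandwich n u (sandwich n v x)) ∧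
      ∀ x, h x = s.mul u (s.mul x v) := by
  let U := Units.mk0 _ hu
  let V := Units.mk0 _ hv
  obtain ⟨f, hf, hf'⟩ := exists_linearEquiv_of_map_eq hn (sandwich n u * sandwich n v)
    (U * U * (V * V)) fun x => by
      rw [Module.End.mul_apply, map_sandwich, map_sandwich]; simp [U, V, mul_assoc]
  obtain ⟨g, hg, hg'⟩ := exists_linearEquiv_of_map_eq hn (s.r u * s.ell v)
    (s.multiplier * s.multiplier * (U * V)) fun x => by
      rw [Module.End.mul_apply, r_apply, ell_apply, s.norm_mul, s.norm_mul]; simp [U, V]; ring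
  obtain ⟨h, hh, hh'⟩ := exists_linearEquiv_of_map_eq hn (s.ell u * s.r v)
    (s.multiplier * s.multiplier * (U * V)) fun x => by
      rw [Module.End.mul_apply, r_apply, ell_apply, s.norm_mul, s.norm_mul]; simp [U, V]; ring
  refine ⟨f, g, h, ⟨⟨_, hf'⟩, ⟨_, hg'⟩, ⟨_, hh'⟩, U * V, fun y z => ?_⟩, hf, hh⟩
  rw [hf, hg, hh]
  have hl : (s.multiplier : F) ≠ 0 := s.multiplier.ne_zero
  refine smul_right_injective S hl ?_
  simp only [Module.End.mul_apply, r_apply, ell_apply, Units.val_mul, U, V, Units.val_mk0]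
  rw [s.sandwich_mul hn, s.mul_mul_right hn, map_smul, LinearMap.smul_apply, mul_comm _ (n u),
    mul_smul, s.mul_sandwich hn, s.mul_mul_left hn]
  simp only [map_smul, LinearMap.smul_apply, smul_smul]
  congr 1
  ring

/-- The product `f` of two reflections fixes, up to a scalar, a nonsingular vector orthogonal to `u`
and `v`, while `h = ℓ_u r_v` has no nonsingular eigenvector when `u` and `v` are independent. -/
theorem exists_trialityTriple_not_conj (s : SymmetricComposition n)
    (hdim : Module.finrank F S = 8) (hn : n.polarBilin.SeparatingLeft) :
    ∃ f g h : GOPlus n, s.TrialityTriple f.1 g.1 h.1 ∧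
      ∀ q : PGOPlus n, (h : PGOPlus n) ≠ q * f * q⁻¹ := by
  have : Module.Finite F S := Module.finite_of_finrank_pos (by lia)
  obtain ⟨x, -, -, hx⟩ := exists_ne_zero_of_linear_forms hdim hn 0 0
  obtain ⟨u, hxu, -, hu⟩ := exists_ne_zero_of_linear_forms hdim hn (n.polarBilin x) 0
  have hu0 : u ≠ 0 := by rintro rfl; simp at hu
  -- The form `φ` is nonzero at `u` and zero at `v`, which witnesses their independence.
  obtain ⟨φ, hφ⟩ := Module.Projective.exists_dual_ne_zero F hu0
  obtain ⟨v, hxv, hφv, hv⟩ := exists_ne_zero_of_linear_forms hdim hn (n.polarBilin x) φ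
  rw [QuadraticMap.polarBilin_apply_apply, QuadraticMap.polar_comm] at hxu hxv
  obtain ⟨f, g, h, t, hf, hh⟩ := s.exists_trialityTriple_of_ne_zero hn hu hv
  obtain ⟨hf', hg', hh'⟩ := t.mem_GOPlus hdim hn
  refine ⟨⟨f, hf'⟩, ⟨g, hg'⟩, ⟨h, hh'⟩, t, fun q => ?_⟩
  induction q using QuotientGroup.induction_on with
  | H q =>
  intro hq
  rw [eq_mul_inv_iff_mul_eq, ← QuotientGroup.mk_mul, ← QuotientGroup.mk_mul, eq_comm,
    mk_eq_mk_iff] at hq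
  obtain ⟨c, hc⟩ := hq
  have hfx : f x = (n u * n v) • x := by
    rw [hf, sandwich_apply v, hxv, zero_smul, zero_sub, map_neg, map_smul, sandwich_apply, hxu,
      zero_smul, zero_sub, smul_neg, neg_neg, smul_smul, mul_comm]
  have hqx : s.mul u (s.mul (q.1 x) v) = ((c : F) * (n u * n v)) • q.1 x := by
    have h₁ : h (q.1 x) = (c : F) • q.1 (f x) := hc x
    rw [hh, hfx, map_smul, smul_smul] at h₁
    exact h₁
  obtain ⟨μ, hμ, -⟩ := q.2
  have hnq : n (q.1 x) ≠ 0 := by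
    rw [hμ]; exact mul_ne_zero μ.ne_zero hx
  -- Multiplying by `u` and then by `q x` cancels the products and makes `v` a multiple of `u`.
  have h₂ := congr_arg (fun w => s.mul (s.mul w u) (q.1 x)) hqx
  simp only [s.mul_mul_left hn, map_smul, LinearMap.smul_apply] at h₂
  have h₃ := congr_arg φ h₂
  simp only [map_smul, hφv, smul_eq_mul, mul_zero] at h₃
  have hl : (s.multiplier : F) ≠ 0 := s.multiplier.ne_zero
  have hc0 : (c : F) ≠ 0 := c.ne_zero
  simp [hφ, hl, hc0, hu, hv, hnq] at h₃

/-- Used to absorb the scalar `k` of a twist into its first factor. -/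
theorem smul_mem_GOPlus (s : SymmetricComposition n) (hdim : Module.finrank F S = 8)
    (hn : n.polarBilin.SeparatingLeft) (k : Fˣ) :
    DistribMulAction.toModuleAut F S k ∈ GOPlus n := by
  have hk : IsSimilarity n (DistribMulAction.toModuleAut F S k) (k * k) := fun x => by
    change n ((k : F) • x) = _
    rw [QuadraticMap.map_smul]; simp
  refine (TrialityTriple.mem_GOPlus (s := s) (g := 1) (h := DistribMulAction.toModuleAut F S k)
    ⟨⟨_, hk⟩, ⟨1, IsSimilarity.one n⟩, ⟨_, hk⟩, 1, fun y z => ?_⟩ hdim hn).1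
  change s.mul ((k : F) • y) z = ((1 : Fˣ) : F) • (k : F) • s.mul y z
  simp

theorem mem_GOPlus_of_alpha_eq (hdim : Module.finrank F S = 8)
    (hn : n.polarBilin.SeparatingLeft) {a b : S ≃ₗ[F] S}
    (H : ∀ z, d.alpha hn z = (a.conj (s.alpha hn z).1, b.conj (s.alpha hn z).2)) :
    a ∈ GOPlus n ∧ b ∈ GOPlus n := by
  obtain ⟨ha, -, hb⟩ := (exists_twist_of_alpha_eq hdim hn H).1.mem_GOPlus hdim hn
  exact ⟨(GOPlus n).inv_mem_iff.1 ha, hb⟩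

theorem isTwist_of_alpha_eq (hdim : Module.finrank F S = 8)
    (hn : n.polarBilin.SeparatingLeft) {a b : S ≃ₗ[F] S}
    (H : ∀ z, d.alpha hn z = (a.conj (s.alpha hn z).1, b.conj (s.alpha hn z).2)) :
    d.IsTwist s := by
  obtain ⟨ha, hb⟩ := mem_GOPlus_of_alpha_eq hdim hn H
  obtain ⟨-, k, hk⟩ := exists_twist_of_alpha_eq hdim hn H
  refine ⟨_, mul_mem (s.smul_mem_GOPlus hdim hn k) (inv_mem ha), b⁻¹, inv_mem hb, fun x y => ?_⟩
  change _ = s.mul ((k : F) • a⁻¹ x) _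
  rw [hk, map_smul, LinearMap.smul_apply]

/-! ### Exclusion of the wrong alternative in (1) and (2). -/

theorem not_congrModInn_of_alpha_op (hdim : Module.finrank F S = 8)
    (hn : n.polarBilin.SeparatingLeft) {a b : S ≃ₗ[F] S}
    (H : ∀ z, d.alpha hn z = (a.conj (s.op.alpha hn z).1, b.conj (s.op.alpha hn z).2)) :
    ¬CongrModInn n (s.rho hn) (d.rho hn) := by
  rintro ⟨p, hp⟩
  have : Nontrivial S := Module.nontrivial_of_finrank_pos (R := F) (by lia)
  obtain ⟨ha, hb⟩ := mem_GOPlus_of_alpha_eq hdim hn H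
  obtain ⟨f, g, h, t, hfh⟩ := s.exists_trialityTriple_not_conj hdim hn
  lift a to GOPlus n using ha
  lift b to GOPlus n using hb
  -- At `[g]`, the automorphism of `s` gives `[h]` and that of `d` a conjugate of `[f]`.
  have D := ((t.rotate hn).rotate hn).diagram hn
  have h₁ := rho_mk (s := d) hdim (D.op.conj H) (f := g) (g := a * f * a⁻¹) (h := b * h * b⁻¹)
  have h₂ := hp g
  rw [rho_mk hdim D, h₁] at h₂
  refine hfh (p * a) (h₂.trans ?_)
  simp only [QuotientGroup.mk_mul, QuotientGroup.mk_inv]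
  group

theorem not_congrModInn_inv_of_alpha (hdim : Module.finrank F S = 8)
    (hn : n.polarBilin.SeparatingLeft) {a b : S ≃ₗ[F] S}
    (H : ∀ z, d.alpha hn z = (a.conj (s.alpha hn z).1, b.conj (s.alpha hn z).2))
    {τ : PGOPlus n → PGOPlus n} (hτ : Function.LeftInverse τ (d.rho hn)) :
    ¬CongrModInn n (s.rho hn) τ := by
  rintro ⟨p, hp⟩
  have : Nontrivial S := Module.nontrivial_of_finrank_pos (R := F) (by lia)
  have T := (exists_twist_of_alpha_eq hdim hn H).1
  obtain ⟨ha, hb⟩ := mem_GOPlus_of_alpha_eq hdim hn H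
  obtain ⟨f, g, h, t, hfh⟩ := s.exists_trialityTriple_not_conj hdim hn
  lift a to GOPlus n using ha
  lift b to GOPlus n using hb
  have h₁ := rho_mk hdim ((t.diagram hn).conj H) (f := f) (g := a * g * a⁻¹) (h := b * h * b⁻¹)
  -- Conjugating `(g, h, f)` by the triple of the twist gives a triple starting with `a g a⁻¹`,
  -- which represents `ρ_d [f]`. Hence `ρ_s (ρ_d [f])` is a conjugate of `[h]`, while `τ (ρ_d [f]) =
  -- [f]`.
  have T' := (T.inv.mul ((t.rotate hn).rotate hn)).mul T
  have h₂ := rho_mk hdim (T'.diagram hn) (f := a⁻¹⁻¹ * g * a⁻¹)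
    (g := (b⁻¹ * a)⁻¹ * h * (b⁻¹ * a)) (h := b⁻¹ * f * b)
  have h₃ := hp (d.rho hn f)
  rw [inv_inv] at h₂
  rw [hτ, h₁, h₂, QuotientGroup.mk_mul, QuotientGroup.mk_mul, QuotientGroup.mk_inv] at h₃
  refine hfh ((b⁻¹ * a : GOPlus n) * p) ?_
  rw [mul_inv_rev, mul_assoc, mul_assoc, ← mul_assoc _ _ ((b⁻¹ * a : GOPlus n) : PGOPlus n)⁻¹,
    ← mul_assoc _ _ ((b⁻¹ * a : GOPlus n) : PGOPlus n)⁻¹, ← mul_assoc p, ← h₃]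
  group

end SymmetricComposition

end Triality

end

theorem mainTheorem8 {F : Type u} {S : Type v} [Field F] [AddCommGroup S] [Module F S]
    (n : QuadraticForm F S) (hdim : Module.finrank F S = 8)
    (hn : n.polarBilin.SeparatingLeft)
    (star diam : Triality.SymmetricComposition n) :
    (Triality.CongrModInn n (star.rho hn) (diam.rho hn) →
      ∃ f ∈ Triality.GOPlus n, ∃ g ∈ Triality.GOPlus n,
        ∀ x y, diam.mul x y = star.mul (f x) (g y)) ∧
    (∀ diamInv : Triality.PGOPlus n → Triality.PGOPlus n,
      Function.LeftInverse diamInv (diam.rho hn) →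
      Function.RightInverse diamInv (diam.rho hn) →
      Triality.CongrModInn n (star.rho hn) diamInv →
      ∃ f ∈ Triality.GOPlus n, ∃ g ∈ Triality.GOPlus n,
        ∀ x y, diam.mul x y = star.mul (g y) (f x)) ∧
    (diam.IsTwist star ∨ diam.IsTwist star.op) := by
  obtain ⟨a, b, H | H⟩ := star.exists_alpha_eq diam hdim hn
  · have ht := Triality.SymmetricComposition.isTwist_of_alpha_eq hdim hn H
    exact ⟨fun _ => ht, fun τ hτ _ hc => absurd hc
      (Triality.SymmetricComposition.not_congrModInn_inv_of_alpha hdim hn H hτ), Or.inl ht⟩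
  · have ht := Triality.SymmetricComposition.isTwist_of_alpha_eq hdim hn H
    exact ⟨fun hc => absurd hc
      (Triality.SymmetricComposition.not_congrModInn_of_alpha_op hdim hn H),
      fun _ _ _ _ => ht, Or.inr ht⟩
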